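/- Let $\mathcal M$ be a type III factor acting on a separable complex Hilbert space, i.e. a nonzero von Neumann algebra whose center consists of the scalar multiples of the identity and in which no nonzero projection is finite (a projection is finite if it is not Murray–von Neumann equivalent in $\mathcal M$ to a proper subprojection of itself). A (generalized) semi-norm associated to $\mathcal M$ is a map $|||\cdot|||:\mathcal M\to[0,\infty]$ such that $|||\lambda T|||=|\lambda|\,|||T|||$ (with $0\cdot\infty=0$) and $|||S+T|||\le|||S|||+|||T|||$ for all $S,T\in\mathcal M$ and $\lambda\in\mathbb C$, and such that $0<|||T|||<\infty$ for some nonzero $T\in\mathcal M$. It is unitarily invariant if $|||UTV|||=|||T|||$ for all $T\in\mathcal M$ and all unitary operators $U,V\in\mathcal M$. If $|||\cdot|||$ is a unitarily invariant semi-norm associated to $\mathcal M$, then there exists $a>0$ such that $|||T|||=a\|T\|$ for all $T\in\mathcal M$, where $\|\cdot\|$ is the operator norm. Conversely, $a\|\cdot\|$ is a unitarily invariant semi-norm associated to $\mathcal M$ for every $a>0$. Thus, up to scale, the operator norm is the unique unitarily invariant semi-norm associated to $\mathcal M$. -/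

import Mathlib

open scoped ENNReal

/-- Murray–von Neumann equivalence of projections: `e = v* v` and `f = v v*` for some `v` in the
algebra (such a `v` is automatically a partial isometry when `e` is a projection). -/
def MurrayVonNeumannEquiv {A : Type*} [Mul A] [Star A] (e f : A) : Prop :=
  ∃ v : A, star v * v = e ∧ v * star v = f

/-- A projection `e` is finite if it is not equivalent to a proper subprojection: every projection
`f ≤ e` (that is, `f * e = f`) with `e ∼ f` equals `e`. -/
structure IsFiniteProjection {A : Type*} [Mul A] [Star A] (e : A) : Prop where
  isStarProjection : IsStarProjection e
  eq_of_equiv : ∀ f : A, IsStarProjection f → f * e = f → MurrayVonNeumannEquiv e f → f = e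

namespace VonNeumannAlgebra

variable {H : Type*} [NormedAddCommGroup H] [InnerProductSpace ℂ H] [CompleteSpace H]

/-- A factor: a nonzero von Neumann algebra whose center consists of the scalar multiples of the
identity. -/
structure IsFactor (M : VonNeumannAlgebra H) : Prop where
  nontrivial : Nontrivial M.toStarSubalgebra
  isCentral : Algebra.IsCentral ℂ M.toStarSubalgebra

/-- A factor of type III: a factor without nonzero finite projections. -/
structure IsTypeIIIFactor (M : VonNeumannAlgebra H) : Prop where
  isFactor : M.IsFactor
  eq_zero_of_isFiniteProjection : ∀ e : M.toStarSubalgebra, IsFiniteProjection e → e = 0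

/-- A (generalized) semi-norm associated to `M`: a map `M → [0, ∞]` that is absolutely homogeneous
(with `0 * ∞ = 0`), subadditive, and nontrivial in the sense that `0 < p T < ∞` for some
nonzero `T`. -/
structure IsGeneralizedSeminorm (M : VonNeumannAlgebra H) (p : M.toStarSubalgebra → ℝ≥0∞) :
    Prop where
  smul : ∀ (c : ℂ) (T : M.toStarSubalgebra), p (c • T) = ENNReal.ofReal ‖c‖ * p T
  add_le : ∀ S T : M.toStarSubalgebra, p (S + T) ≤ p S + p T
  exists_pos_lt_top : ∃ T : M.toStarSubalgebra, T ≠ 0 ∧ 0 < p T ∧ p T < ∞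

/-- Unitary invariance: `p (U T V) = p T` for all `T` in `M` and all unitaries `U`, `V` in `M`. -/
def IsUnitarilyInvariant (M : VonNeumannAlgebra H) (p : M.toStarSubalgebra → ℝ≥0∞) : Prop :=
  ∀ U ∈ unitary M.toStarSubalgebra, ∀ V ∈ unitary M.toStarSubalgebra,
    ∀ T : M.toStarSubalgebra, p (U * T * V) = p T

end VonNeumannAlgebra

/-! Everything reduces to `p T = ‖T‖ * p 1`, by two bounds. Sums of unitaries approximate
contractions well enough that unitary invariance gives `p (A * T * B) ≤ ‖A‖ * ‖B‖ * p T`, hence `p T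
≤ ‖T‖ * p 1`. Conversely, for `0 < δ < ‖T‖`, a spectral projection `e ≠ 0` of `star T * T` has `T`
bounded below by `δ` on its range. Type III makes `e` infinite, and in a separable factor some
isometry `v` of the algebra has range under `e`. Then `T * v` has a left inverse `A` with `‖A‖ ≤
δ⁻¹`, so `p 1 ≤ δ⁻¹ * p T`; let `δ` tend to `‖T‖`. The isometry `v` comes from packing: an infinite
`e` contains countably many orthogonal copies of some `g ≠ 0`, and `1` is covered by countably many
translates of `g`. -/

section CStar

/-! ### Sums of unitaries in C*-algebras -/

variable {A : Type*} [CStarAlgebra A]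

/-- An invertible contraction is the mean of two unitaries. -/
lemma IsUnit.exists_unitary_add_unitary {x : A} (hx : IsUnit x) (hx1 : ‖x‖ ≤ 1) :
    ∃ v ∈ unitary A, ∃ w ∈ unitary A, x + x = v + w := by
  let _ := CStarAlgebra.spectralOrder A
  let _ := CStarAlgebra.spectralOrderedRing A
  have hsq : CFC.abs x * CFC.abs x = star x * x := CFC.abs_mul_abs x
  have hu : IsUnit (CFC.abs x) := by
    rw [← isUnit_pow_iff two_ne_zero, sq, hsq]
    exact hx.star.mul hx
  have hsa : IsSelfAdjoint (CFC.abs x) := (CFC.abs_nonneg x).isSelfAdjoint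
  obtain ⟨h, hh⟩ := hu
  have hstar : star (h : A) = h := by rw [hh]; exact hsa.star_eq
  have hstar' : star (↑h⁻¹ : A) = ↑h⁻¹ := by
    have : star h = h := Units.ext hstar
    rw [← Units.coe_star_inv, this]
  -- The polar part of an invertible element is unitary.
  have hW : x * ↑h⁻¹ ∈ unitary A := by
    have h1 : star (x * ↑h⁻¹) * (x * ↑h⁻¹) = 1 := by
      rw [star_mul, hstar', mul_assoc, ← mul_assoc (star x), ← hsq, ← hh]
      simp
    refine Unitary.mem_iff.2 ⟨h1, ?_⟩
    obtain ⟨y, hy⟩ : IsUnit (x * (↑h⁻¹ : A)) := hx.mul h⁻¹.isUnit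
    rw [← hy] at h1 ⊢
    rw [← Units.inv_eq_of_mul_eq_one_left h1, Units.mul_inv]
  let a : selfAdjoint A := ⟨CFC.abs x, hsa⟩
  have ha : ‖a‖ ≤ 1 := by
    change ‖CFC.abs x‖ ≤ 1
    rwa [CFC.norm_abs]
  -- `k = |x| + i √(1 - |x|²)`, so `|x|` is the mean of `k` and `star k`.
  let k := selfAdjoint.unitarySelfAddISMul a ha
  refine ⟨x * ↑h⁻¹ * k, mul_mem hW k.2, x * ↑h⁻¹ * star k, mul_mem hW (star k).2, ?_⟩
  have hk : (k : A) + (star k : unitary A) = h + h := by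
    rw [Unitary.coe_star, selfAdjoint.star_coe_unitarySelfAddISMul,
      selfAdjoint.unitarySelfAddISMul_coe, hh]
    simp only [a]
    abel
  rw [← mul_add, hk, mul_add]
  simp

/-- The sum of a unitary and a strict contraction is a sum of two unitaries. -/
lemma exists_unitary_add_unitary_of_norm_lt_one {a u : A} (ha : ‖a‖ < 1) (hu : u ∈ unitary A) :
    ∃ v ∈ unitary A, ∃ w ∈ unitary A, u + a = v + w := by
  obtain _ | _ := subsingleton_or_nontrivial A
  · exact ⟨u, hu, u, hu, Subsingleton.elim _ _⟩
  have hb : ‖star u * a‖ < 1 := by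
    rwa [CStarRing.norm_mem_unitary_mul a (Unitary.star_mem hu)]
  have hunit : IsUnit (1 + star u * a) := by
    have := isUnit_one_sub_of_norm_lt_one (x := -(star u * a)) (by rwa [norm_neg])
    simpa using this
  obtain ⟨v, hv, w, hw, h⟩ := IsUnit.exists_unitary_add_unitary
    (x := (2⁻¹ : ℂ) • (1 + star u * a))
    (hunit.smul (Units.mk0 (2⁻¹ : ℂ) (by norm_num))) (by
      rw [norm_smul]
      have : ‖1 + star u * a‖ ≤ 1 + 1 := (norm_add_le _ _).trans (by
        rw [CStarRing.norm_one]; gcongr)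
      norm_num
      linarith)
  refine ⟨u * v, mul_mem hu hv, u * w, mul_mem hu hw, ?_⟩
  rw [← mul_add, ← h, ← add_smul]
  norm_num
  rw [mul_add, ← mul_assoc, Unitary.mul_star_self_of_mem hu]
  simp

/-- A subadditive, absolutely homogeneous function bounded by `C` on the unitaries is bounded by
`C` on the open unit ball. -/
lemma le_of_norm_lt_one_of_forall_unitary {q : A → ℝ≥0∞} {C : ℝ≥0∞}
    (smul : ∀ (c : ℂ) (x : A), q (c • x) = ENNReal.ofReal ‖c‖ * q x)
    (add_le : ∀ x y : A, q (x + y) ≤ q x + q y) (hC : ∀ u ∈ unitary A, q u ≤ C)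
    {a : A} (ha : ‖a‖ < 1) : q a ≤ C := by
  -- Each copy of `a` is absorbed by a unitary, which releases one more unitary: `u + n a` is a sum
  -- of `n + 1` unitaries. Dividing by `n` then makes the excess negligible.
  have key : ∀ (n : ℕ), ∀ u ∈ unitary A, q (u + (n : ℂ) • a) ≤ (n + 1) * C := by
    intro n
    induction n with
    | zero => intro u hu; simpa using hC u hu
    | succ n ih =>
      intro u hu
      obtain ⟨v, hv, w, hw, h⟩ := exists_unitary_add_unitary_of_norm_lt_one ha hu
      have : u + ((n + 1 : ℕ) : ℂ) • a = (v + (n : ℂ) • a) + w := by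
        push_cast
        rw [add_smul, one_smul, add_comm ((n : ℂ) • a), ← add_assoc, h]
        abel
      rw [this]
      calc _ ≤ (n + 1) * C + C := (add_le _ _).trans (add_le_add (ih v hv) (hC w hw))
        _ = _ := by push_cast; ring
  have key2 : ∀ n : ℕ, n * q a ≤ (n + 2) * C := by
    intro n
    have h1 : q ((n : ℂ) • a) = n * q a := by rw [smul]; simp
    have h2 : (n : ℂ) • a = (1 + (n : ℂ) • a) + (-1) := by abel
    rw [← h1, h2]
    calc _ ≤ (n + 1) * C + C :=
          (add_le _ _).trans (add_le_add (key n 1 (one_mem _)) (hC _ (by simp [Unitary.mem_iff])))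
      _ = _ := by ring
  obtain rfl | hCt := eq_or_ne C ⊤
  · exact le_top
  have hqt : q a ≠ ⊤ := by
    intro h
    have := key2 1
    rw [h] at this
    refine absurd this (not_le.2 ?_)
    simpa using ENNReal.mul_lt_top (by finiteness) hCt.lt_top
  lift C to NNReal using hCt
  generalize hr : q a = r at *
  lift r to NNReal using hqt
  norm_cast
  by_contra! hlt
  have hpos : (0 : ℝ) < r - C := sub_pos.2 (by exact_mod_cast hlt)
  obtain ⟨n, hn⟩ := exists_nat_gt (2 * C / (r - C) : ℝ)
  rw [div_lt_iff₀ hpos] at hn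
  have h3 : (n * r : ℝ) ≤ (n + 2) * C := by exact_mod_cast key2 n
  nlinarith

/-- A subadditive, absolutely homogeneous function bounded by `C` on the unitaries is bounded by
`C` times the norm. -/
lemma le_norm_mul_of_forall_unitary {q : A → ℝ≥0∞} {C : ℝ≥0∞}
    (smul : ∀ (c : ℂ) (x : A), q (c • x) = ENNReal.ofReal ‖c‖ * q x)
    (add_le : ∀ x y : A, q (x + y) ≤ q x + q y) (hC : ∀ u ∈ unitary A, q u ≤ C)
    (a : A) : q a ≤ ENNReal.ofReal ‖a‖ * C := by
  -- Zero is treated apart because the limit below fails there when `C = ∞`.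
  obtain rfl | ha := eq_or_ne a 0
  · simpa using (smul 0 0).le
  have hpos : 0 < ‖a‖ := norm_pos_iff.2 ha
  have h : ∀ r : ℝ, ‖a‖ < r → q a ≤ ENNReal.ofReal r * C := by
    intro r hr
    have hr0 : 0 < r := hpos.trans hr
    have h1 := le_of_norm_lt_one_of_forall_unitary smul add_le hC (a := ((r⁻¹ : ℝ) : ℂ) • a) (by
      rw [norm_smul, Complex.norm_real, norm_inv, Real.norm_of_nonneg hr0.le, inv_mul_lt_iff₀ hr0]
      simpa)
    have h2 : a = (r : ℂ) • (((r⁻¹ : ℝ) : ℂ) • a) := by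
      rw [smul_smul, ← Complex.ofReal_mul, mul_inv_cancel₀ hr0.ne']; simp
    rw [h2, smul, Complex.norm_real, Real.norm_of_nonneg hr0.le]
    gcongr
  have ht : Filter.Tendsto (fun r : ℝ => ENNReal.ofReal r * C) (nhdsWithin ‖a‖ (Set.Ioi ‖a‖))
      (nhds (ENNReal.ofReal ‖a‖ * C)) :=
    ENNReal.Tendsto.mul_const
      ((ENNReal.continuous_ofReal.tendsto _).mono_left nhdsWithin_le_nhds) (Or.inl (by simpa))
  exact ge_of_tendsto ht (Filter.eventually_of_mem self_mem_nhdsWithin h)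

end CStar

/-! ### Infinite projections and orthogonal translates -/

section StarRing

variable {A : Type*} [Ring A] [StarRing A]

/-- A projection that is not finite yields an isometry commuting with it and a nonzero
subprojection orthogonal to the range of the isometry. -/
lemma IsStarProjection.exists_isometry_of_not_isFiniteProjection {e : A} (he : IsStarProjection e)
    (h : ¬ IsFiniteProjection e) :
    ∃ w g : A, star w * w = 1 ∧ e * w = w * e ∧ IsStarProjection g ∧ g ≠ 0 ∧ e * g = g ∧
      star w * g = 0 := by
  have : ∃ f : A, IsStarProjection f ∧ f * e = f ∧ MurrayVonNeumannEquiv e f ∧ f ≠ e := by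
    by_contra! hcon
    exact h ⟨he, hcon⟩
  obtain ⟨f, hf, hfe, ⟨v, hv, hv'⟩, hne⟩ := this
  have hee : e * e = e := he.isIdempotentElem
  have hes : star e = e := he.isSelfAdjoint
  have hff : f * f = f := hf.isIdempotentElem
  have hfs : star f = f := hf.isSelfAdjoint
  have hef : e * f = f := by simpa [hes, hfs] using congr(star $hfe)
  have hvv : star v * (f * v) = e := by
    rw [← hv', mul_assoc, hv, ← mul_assoc, hv, hee]
  -- The isometry shifts `e` onto `f` and fixes `1 - e`; what it misses is `e - f`.
  refine ⟨f * v * e + (1 - e), e - f, ?_, ?_, ⟨?_, ?_⟩, sub_ne_zero.2 hne.symm, ?_, ?_⟩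
  · have h1 : e * star v * f * (f * v * e) = e := by
      calc _ = e * (star v * ((f * f) * v)) * e := by noncomm_ring
        _ = e := by rw [hff, hvv, hee, hee]
    have h2 : e * star v * f * (1 - e) = 0 := by rw [mul_assoc, mul_sub, hfe]; simp
    have h3 : (1 - e) * (f * v * e) = 0 := by
      rw [mul_assoc, ← mul_assoc, sub_mul, hef]; simp
    have h4 : (1 - e) * (1 - e) = 1 - e := he.one_sub.isIdempotentElem
    simp only [star_add, star_mul, star_sub, star_one, hes, hfs]
    rw [← mul_assoc, add_mul, mul_add, mul_add, h1, h2, h3, h4]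
    abel
  · simp only [mul_add, add_mul, mul_sub, sub_mul, hee, mul_assoc, mul_one, one_mul]
    rw [← mul_assoc, hef]
  · simp only [IsIdempotentElem, mul_sub, sub_mul, hee, hef, hfe, hff]
    abel
  · simp [IsSelfAdjoint, hes, hfs]
  · rw [mul_sub, hee, hef]
  · simp only [star_add, star_mul, star_sub, star_one, hes, hfs, mul_sub, sub_mul, add_mul,
      mul_assoc, hfe, hff, hee, hef, one_mul]
    abel

lemma star_pow_mul_pow {w : A} (hw : star w * w = 1) (n : ℕ) : star w ^ n * w ^ n = 1 := by
  induction n with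
  | zero => simp
  | succ n ih => rw [pow_succ, pow_succ', mul_assoc, ← mul_assoc (star w) w, hw, one_mul, ih]

/-- Translates of a projection orthogonal to the range of an isometry are orthogonal. -/
lemma mul_star_pow_mul_pow_mul {w g : A} (hw : star w * w = 1) (hg : IsStarProjection g)
    (hwg : star w * g = 0) (m n : ℕ) :
    g * star w ^ m * (w ^ n * g) = if n = m then g else 0 := by
  have hgg : g * g = g := hg.isIdempotentElem
  have hgw : g * w = 0 := by simpa [hg.isSelfAdjoint.star_eq] using congr(star $hwg)
  obtain h | rfl | h := lt_trichotomy n m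
  · obtain ⟨k, rfl⟩ := Nat.exists_eq_add_of_lt h
    rw [if_neg (by omega), show n + k + 1 = (k + 1) + n by ring, pow_add, mul_assoc,
      mul_assoc (star w ^ (k + 1)), ← mul_assoc (star w ^ n), star_pow_mul_pow hw, one_mul,
      pow_succ, mul_assoc (star w ^ k), hwg, mul_zero, mul_zero]
  · rw [if_pos rfl, mul_assoc, ← mul_assoc (star w ^ n), star_pow_mul_pow hw, one_mul, hgg]
  · obtain ⟨k, rfl⟩ := Nat.exists_eq_add_of_lt h
    rw [if_neg (by omega), show m + k + 1 = m + (k + 1) by ring, pow_add, mul_assoc,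
      ← mul_assoc (star w ^ m), ← mul_assoc (star w ^ m), star_pow_mul_pow hw, one_mul,
      pow_succ', ← mul_assoc, ← mul_assoc, hgw, zero_mul, zero_mul]

end StarRing

/-! ### Central support, polar decomposition and isometries under infinite projections -/

namespace VonNeumannAlgebra

variable {H : Type*} [NormedAddCommGroup H] [InnerProductSpace ℂ H] [CompleteSpace H]
  {M : VonNeumannAlgebra H}

lemma mem_of_forall_mem_commutant {x : H →L[ℂ] H} (h : ∀ y ∈ M.commutant, y * x = x * y) :
    x ∈ M := by
  rw [← M.commutant_commutant]
  exact mem_commutant_iff.2 h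

lemma mul_comm_of_mem_commutant {x y : H →L[ℂ] H} (hx : x ∈ M) (hy : y ∈ M.commutant) :
    y * x = x * y :=
  (mem_commutant_iff.1 hy x hx).symm

variable (M) in
lemma isClosed_toStarSubalgebra : IsClosed (M.toStarSubalgebra : Set (H →L[ℂ] H)) := by
  rw [coe_toStarSubalgebra, ← M.centralizer_centralizer]
  exact Set.isClosed_centralizer _

lemma apply_comm_of_mem_commutant {x y : H →L[ℂ] H} (hx : x ∈ M) (hy : y ∈ M.commutant) (h : H) :
    y (x h) = x (y h) :=
  congr($(mul_comm_of_mem_commutant hx hy) h)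

/-- In a factor, the central support of a nonzero operator is the identity. -/
lemma IsFactor.eq_zero_of_forall_apply_eq_zero (hM : M.IsFactor) {g : H →L[ℂ] H} (hg : g ∈ M)
    (hg0 : g ≠ 0) {h : H} (hh : ∀ x ∈ M, g (x h) = 0) : h = 0 := by
  -- `K` is invariant under both `M` and its commutant, so its projection is central, hence scalar.
  -- A nonzero scalar would give `K = H` and `g = 0`.
  let K : Submodule ℂ H :=
    { carrier := {h | ∀ x ∈ M, g (x h) = 0}
      add_mem' := fun ha hb x hx => by simp [ha x hx, hb x hx]
      zero_mem' := fun x _ => by simp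
      smul_mem' := fun c a ha x hx => by simp [ha x hx] }
  have hKc : IsClosed (K : Set H) := by
    have : (K : Set H) = ⋂ x ∈ M, {h | g (x h) = 0} := by
      ext; simp [K]
    rw [this]
    exact isClosed_biInter fun x _ => isClosed_eq (by fun_prop) continuous_const
  have : CompleteSpace K := hKc.completeSpace_coe
  have hP : IsStarProjection K.starProjection := isStarProjection_starProjection
  have hPM : K.starProjection ∈ M := by
    rw [IsStarProjection.mem_iff hP]
    intro y hy
    rw [Submodule.range_starProjection]
    intro a ha x hx
    change g (x (y a)) = 0
    rw [← apply_comm_of_mem_commutant hx hy, ← apply_comm_of_mem_commutant hg hy, ha x hx, map_zero]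
  have hPM' : K.starProjection ∈ M.commutant := by
    rw [IsStarProjection.mem_iff hP, commutant_commutant]
    intro y hy
    rw [Submodule.range_starProjection]
    intro a ha x hx
    exact ha (x * y) (mul_mem hx hy)
  let P : M.toStarSubalgebra := ⟨K.starProjection, hPM⟩
  have hcenter : P ∈ Subalgebra.center ℂ M.toStarSubalgebra := by
    rw [Subalgebra.mem_center_iff]
    intro b
    exact Subtype.ext (mem_commutant_iff.1 hPM' b b.2)
  obtain ⟨c, hc⟩ := Algebra.mem_bot.1 (hM.isCentral.out hcenter)
  have hc' : ∀ a, K.starProjection a = c • a := fun a => by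
    have : (algebraMap ℂ M.toStarSubalgebra c : H →L[ℂ] H) = K.starProjection := congr($hc)
    rw [← this]
    simp [Algebra.algebraMap_eq_smul_one]
  have hhK : K.starProjection h = h := Submodule.starProjection_eq_self_iff.2 hh
  obtain rfl | hc0 := eq_or_ne c 0
  · rw [← hhK, hc', zero_smul]
  · refine absurd (ContinuousLinearMap.ext fun a => ?_) hg0
    have ha : a ∈ K := by
      rw [← inv_smul_smul₀ hc0 a, ← hc']
      exact K.smul_mem _ (Submodule.starProjection_apply_mem _ _)
    exact ha 1 (one_mem M)

/-- Polar decomposition of an injective operator in a von Neumann algebra. -/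
lemma exists_isometry_mul_eq {X : H →L[ℂ] H} (hX : X ∈ M) (hinj : ∀ h, X h = 0 → h = 0) :
    ∃ v ∈ M, ∃ R : H →L[ℂ] H, star v * v = 1 ∧ v * R = X ∧ DenseRange R := by
  obtain ⟨R, hR⟩ : ∃ R : H →L[ℂ] H, R = CFC.abs X := ⟨_, rfl⟩
  have hsa : star R = R := by rw [hR]; exact (CFC.abs_nonneg X).isSelfAdjoint
  have hsq : star R * R = star X * X := by rw [hsa, hR, CFC.abs_mul_abs]
  have hnorm : ∀ h, ‖R h‖ = ‖X h‖ := by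
    intro h
    rw [← sq_eq_sq₀ (norm_nonneg _) (norm_nonneg _), R.apply_norm_sq_eq_inner_adjoint_left,
      X.apply_norm_sq_eq_inner_adjoint_left]
    exact congr(RCLike.re (inner ℂ ($hsq h) h))
  have hdense : DenseRange R := by
    have h1 : R.range.topologicalClosure = ⊤ := by
      rw [Submodule.topologicalClosure_eq_top_iff, ContinuousLinearMap.orthogonal_range,
        ← ContinuousLinearMap.star_eq_adjoint, hsa, LinearMap.ker_eq_bot']
      intro h hh
      apply hinj
      rw [← norm_eq_zero, ← hnorm]
      simpa using hh
    exact Submodule.dense_iff_topologicalClosure_eq_top.2 h1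
  -- `R h ↦ X h` is isometric on the range of `|X|`, which is dense since `X` is injective.
  let v : H →L[ℂ] H := (X : H →ₗ[ℂ] H).extendOfNorm (R : H →ₗ[ℂ] H)
  have hv : ∀ h, v (R h) = X h := fun h =>
    LinearMap.extendOfNorm_eq (f := (X : H →ₗ[ℂ] H)) (e := (R : H →ₗ[ℂ] H)) hdense
      ⟨1, fun x => by simp [hnorm]⟩ h
  refine ⟨v, ?_, R, ?_, ContinuousLinearMap.ext hv, hdense⟩
  · refine mem_of_forall_mem_commutant fun y hy => ?_
    have hcomm : Commute R y := by
      rw [hR]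
      exact Commute.cfcAbs_left (mul_comm_of_mem_commutant hX hy).symm
        (mul_comm_of_mem_commutant hX (star_mem hy)).symm
    refine ContinuousLinearMap.ext fun a => congrFun (hdense.equalizer (by fun_prop) (by fun_prop)
      (funext fun h => ?_)) a
    change y (v (R h)) = v (y (R h))
    rw [hv, show y (R h) = R (y h) from congr($(hcomm.eq.symm) h), hv,
      apply_comm_of_mem_commutant hX hy]
  · have hiso : ∀ a, ‖v a‖ = ‖a‖ := fun a =>
      congrFun (hdense.equalizer (g := fun a => ‖v a‖) (h := fun a => ‖a‖) (by fun_prop)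
        (by fun_prop) (funext fun h => by simp [hv, hnorm])) a
    exact (ContinuousLinearMap.norm_map_iff_adjoint_comp_self v).1 hiso

/-- In a factor on a separable Hilbert space, a nonzero element has a countable family of
translates with trivial common kernel. -/
lemma IsFactor.exists_seq_forall_apply_eq_zero [TopologicalSpace.SeparableSpace H]
    (hM : M.IsFactor) {g : H →L[ℂ] H} (hg : g ∈ M) (hg0 : g ≠ 0) :
    ∃ x : ℕ → H →L[ℂ] H, (∀ n, x n ∈ M) ∧ ∀ h, (∀ n, g (x n h) = 0) → h = 0 := by
  have : SecondCountableTopology H := UniformSpace.secondCountable_of_separable H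
  -- Lindelöf: countably many of these open sets have the same union.
  obtain ⟨T, hT, hU⟩ := TopologicalSpace.isOpen_iUnion_countable
    (fun x : M => {h : H | g ((x : H →L[ℂ] H) h) ≠ 0})
    (fun x => isOpen_ne_fun (by fun_prop) continuous_const)
  obtain ⟨f, hf⟩ := (hT.insert 0).exists_eq_range (Set.insert_nonempty _ _)
  refine ⟨fun n => f n, fun n => (f n).2, fun h hh => hM.eq_zero_of_forall_apply_eq_zero hg hg0 ?_⟩
  by_contra! hcon
  obtain ⟨x, hx, hxh⟩ := hcon
  have h1 : h ∈ ⋃ x : M, {h : H | g ((x : H →L[ℂ] H) h) ≠ 0} := Set.mem_iUnion.2 ⟨⟨x, hx⟩, hxh⟩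
  rw [← hU] at h1
  obtain ⟨y, hy, hyh⟩ := Set.mem_iUnion₂.1 h1
  obtain ⟨n, rfl⟩ : y ∈ Set.range f := hf ▸ Set.mem_insert_of_mem _ hy
  exact hyh (hh n)

/-- In a factor on a separable Hilbert space, the identity is equivalent to a subprojection of any
projection that is not finite. -/
lemma IsFactor.exists_isometry_of_not_isFiniteProjection [TopologicalSpace.SeparableSpace H]
    (hM : M.IsFactor) {e : M.toStarSubalgebra} (he : IsStarProjection e)
    (hfin : ¬ IsFiniteProjection e) :
    ∃ v ∈ M, star v * v = 1 ∧ (e : H →L[ℂ] H) * v = v := by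
  obtain ⟨w', g', hw, hew, hg, hg0, heg, hwg⟩ := he.exists_isometry_of_not_isFiniteProjection hfin
  obtain ⟨x, hxM, hx⟩ := hM.exists_seq_forall_apply_eq_zero g'.2 (by simpa using hg0)
  obtain ⟨w, hwdef⟩ : ∃ w : H →L[ℂ] H, w = w' := ⟨_, rfl⟩
  obtain ⟨g, hgdef⟩ : ∃ g : H →L[ℂ] H, g = g' := ⟨_, rfl⟩
  rw [← hgdef] at hx
  have hwM : w ∈ M := hwdef ▸ w'.2
  have hgM : g ∈ M := hgdef ▸ g'.2
  have horth : ∀ m n : ℕ, g * star w ^ m * (w ^ n * g) = if n = m then g else 0 := by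
    intro m n
    have := congr((($(mul_star_pow_mul_pow_mul hw hg hwg m n) : M.toStarSubalgebra) : H →L[ℂ] H))
    rw [hwdef, hgdef]
    split_ifs at this ⊢ <;> simpa using this
  have hecomm : Commute (e : H →L[ℂ] H) w := by
    rw [hwdef]
    exact congr((($hew : M.toStarSubalgebra) : H →L[ℂ] H))
  have heg' : (e : H →L[ℂ] H) * g = g := by
    rw [hgdef]
    exact congr((($heg : M.toStarSubalgebra) : H →L[ℂ] H))
  -- Positive weights forcing norm convergence of the sum of the `X' n`.
  let c : ℕ → ℝ := fun n => (1 / 2) ^ n / (1 + ‖w ^ n * g * x n‖)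
  have hc : ∀ n, 0 < c n := fun n => by positivity
  let X' : ℕ → H →L[ℂ] H := fun n => w ^ n * g * ((c n : ℂ) • x n)
  have hX'M : ∀ n, X' n ∈ M := fun n =>
    mul_mem (mul_mem (pow_mem hwM n) hgM) (M.toStarSubalgebra.smul_mem (hxM n) _)
  have hsum : Summable X' := by
    refine Summable.of_norm_bounded (g := fun n => (1 / 2 : ℝ) ^ n) summable_geometric_two ?_
    intro n
    simp only [X', mul_smul_comm]
    rw [norm_smul, Complex.norm_real, Real.norm_of_nonneg (hc n).le, div_mul_eq_mul_div,
      div_le_iff₀ (by positivity)]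
    gcongr
    linarith
  obtain ⟨X, hX⟩ := hsum
  have hXM : X ∈ M := mem_of_forall_mem_commutant fun y hy => by
    refine (hX.mul_left y).unique ?_
    simpa only [mul_comm_of_mem_commutant (hX'M _) hy] using hX.mul_right y
  have heX : (e : H →L[ℂ] H) * X = X := by
    refine (hX.mul_left (e : H →L[ℂ] H)).unique ?_
    have : ∀ n, (e : H →L[ℂ] H) * X' n = X' n := fun n => by
      simp only [X']
      rw [← mul_assoc, ← mul_assoc, (hecomm.pow_right n).eq, mul_assoc (w ^ n), heg']
    simpa only [this] using hX
  have hinj : ∀ h, X h = 0 → h = 0 := by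
    intro h hh
    refine hx h fun n => ?_
    -- Orthogonality of the ranges of the `w ^ n * g` isolates the `n`-th term, so `X h = 0` kills
    -- every `g (x n h)`.
    have h1 : g * star w ^ n * X = g * ((c n : ℂ) • x n) := by
      refine (hX.mul_left (g * star w ^ n)).unique ?_
      have h2 : ∀ m, g * star w ^ n * X' m = if m = n then g * ((c n : ℂ) • x n) else 0 := by
        intro m
        simp only [X']
        rw [← mul_assoc, horth]
        split_ifs with hmn
        · rw [hmn]
        · rw [zero_mul]
      simpa only [h2] using hasSum_ite_eq n (g * ((c n : ℂ) • x n))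
    have h3 : (g * ((c n : ℂ) • x n)) h = 0 := by
      rw [← h1]
      simp [hh]
    have hcn : (c n : ℂ) ≠ 0 := by exact_mod_cast (hc n).ne'
    simpa [(hc n).ne'] using h3
  obtain ⟨v, hvM, R, hv, hvR, hdense⟩ := exists_isometry_mul_eq hXM hinj
  refine ⟨v, hvM, hv, ContinuousLinearMap.ext fun a => congrFun (hdense.equalizer
    (g := (e : H →L[ℂ] H) * v) (h := v) (by fun_prop) (by fun_prop) (funext fun h => ?_)) a⟩
  have h1 : (e : H →L[ℂ] H) * v * R = v * R := by rw [mul_assoc, hvR, heX]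
  exact congr($h1 h)

end VonNeumannAlgebra

/-! ### Compression to the identity and comparison with the operator norm -/

namespace VonNeumannAlgebra

variable {H : Type*} [NormedAddCommGroup H] [InnerProductSpace ℂ H] [CompleteSpace H]
  {M : VonNeumannAlgebra H}

/-- The projection onto the closure of the range of an element of a von Neumann algebra belongs to
the algebra. -/
lemma starProjection_closure_range_mem {f : H →L[ℂ] H} (hf : f ∈ M)
    [f.range.topologicalClosure.HasOrthogonalProjection] :
    f.range.topologicalClosure.starProjection ∈ M := by
  rw [IsStarProjection.mem_iff isStarProjection_starProjection]
  intro y hy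
  rw [Submodule.range_starProjection]
  intro a ha
  refine map_mem_closure (s := (f.range : Set H)) (t := (f.range : Set H)) y.continuous ha ?_
  rintro _ ⟨h, rfl⟩
  exact ⟨y h, (apply_comm_of_mem_commutant hf hy h).symm⟩

/-- Below the norm of an operator in a von Neumann algebra there is a nonzero projection in the
algebra on whose range the operator is bounded below. -/
lemma exists_isStarProjection_le_norm_apply {T : H →L[ℂ] H} (hT : T ∈ M) {δ : ℝ} (hδ : 0 ≤ δ)
    (hδT : δ < ‖T‖) :
    ∃ e : M.toStarSubalgebra, IsStarProjection e ∧ e ≠ 0 ∧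
      ∀ h : H, δ * ‖(e : H →L[ℂ] H) h‖ ≤ ‖T ((e : H →L[ℂ] H) h)‖ := by
  obtain ⟨b, hb⟩ : ∃ b : H →L[ℂ] H, b = star T * T - ((δ ^ 2 : ℝ) : ℂ) • 1 := ⟨_, rfl⟩
  have hbM : b ∈ M := by
    rw [hb]
    exact sub_mem (mul_mem (star_mem hT) hT) (M.toStarSubalgebra.smul_mem (one_mem M) _)
  have hbsa : IsSelfAdjoint b := by
    rw [hb]
    refine (IsSelfAdjoint.star_mul_self T).sub ?_
    simp [IsSelfAdjoint, star_smul]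
  have hbinner : ∀ h : H, RCLike.re (inner ℂ (b h) h) = ‖T h‖ ^ 2 - δ ^ 2 * ‖h‖ ^ 2 := by
    intro h
    rw [T.apply_norm_sq_eq_inner_adjoint_left, hb]
    simp only [sub_apply, smul_apply, inner_sub_left,
      inner_smul_left, one_apply_eq_self, map_sub, Complex.conj_ofReal,
      inner_self_eq_norm_sq_to_K]
    congr 1
    rw [← RCLike.ofReal_pow, RCLike.re_mul_ofReal]
    rfl
  -- On the range of `f` the form of `b` is nonnegative, since `b * f = f * f`; that says `‖T y‖ ≥ δ
  -- ‖y‖`. If `f` vanished, `‖T‖ ≤ δ` would follow.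
  obtain ⟨f, hf⟩ : ∃ f : H →L[ℂ] H, f = b⁺ := ⟨_, rfl⟩
  have hf0 : 0 ≤ f := hf ▸ CFC.posPart_nonneg b
  have hbf : b * f = f * f := by
    have h1 : b⁻ * f = 0 := by rw [hf, CFC.negPart_mul_posPart]
    nth_rw 1 [← CFC.posPart_sub_negPart b hbsa]
    rw [sub_mul, h1, sub_zero, ← hf]
  have hfM : f ∈ M := mem_of_forall_mem_commutant fun y hy => by
    have : Commute f y := by
      rw [hf, CFC.posPart_def]
      exact Commute.cfcₙ_real (mul_comm_of_mem_commutant hbM hy).symm _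
    exact this.eq.symm
  have hfne : f ≠ 0 := by
    rintro rfl
    have hb0 : b ≤ 0 := by
      rw [← CFC.posPart_sub_negPart b hbsa, ← hf, zero_sub]
      exact neg_nonpos.2 (CFC.negPart_nonneg b)
    refine hδT.not_ge (T.opNorm_le_bound hδ fun h => ?_)
    have h1 := ((ContinuousLinearMap.le_def _ _).1 hb0).re_inner_nonneg_left h
    rw [zero_sub, neg_apply, inner_neg_left, map_neg, hbinner] at h1
    rw [← sq_le_sq₀ (norm_nonneg _) (by positivity)]
    linarith [mul_pow δ ‖h‖ 2]
  let K := f.range.topologicalClosure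
  have : CompleteSpace K := f.range.isClosed_topologicalClosure.completeSpace_coe
  have hP : IsStarProjection K.starProjection := isStarProjection_starProjection
  refine ⟨⟨K.starProjection, starProjection_closure_range_mem hfM⟩,
    ⟨Subtype.ext hP.isIdempotentElem, Subtype.ext hP.isSelfAdjoint⟩, ?_, fun h => ?_⟩
  · intro h0
    have h0' : K.starProjection = 0 := congr(($h0 : H →L[ℂ] H))
    refine hfne (ContinuousLinearMap.ext fun h => ?_)
    have h1 : f h ∈ K := f.range.le_topologicalClosure ⟨h, rfl⟩
    rw [← Submodule.starProjection_eq_self_iff.2 h1, h0']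
    simp
  · have hK : K.starProjection h ∈ K := Submodule.starProjection_apply_mem _ _
    refine closure_minimal (t := {y : H | δ * ‖y‖ ≤ ‖T y‖}) ?_
      (isClosed_le (by fun_prop) (by fun_prop)) hK
    rintro _ ⟨k, rfl⟩
    have h1 : 0 ≤ RCLike.re (inner ℂ (f (f k)) (f k)) :=
      ((ContinuousLinearMap.nonneg_iff_isPositive f).1 hf0).re_inner_nonneg_left _
    rw [show f (f k) = b (f k) from congr($(hbf.symm) k), hbinner] at h1
    change δ * ‖f k‖ ≤ ‖T (f k)‖
    rw [← sq_le_sq₀ (by positivity) (norm_nonneg _)]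
    linarith [mul_pow δ ‖f k‖ 2]

/-- An operator in a von Neumann algebra that is bounded below has a left inverse in the algebra,
with the expected bound on its norm. -/
lemma exists_mul_eq_one_of_le_norm_apply {Y : H →L[ℂ] H} (hY : Y ∈ M) {δ : ℝ} (hδ : 0 < δ)
    (h : ∀ x, δ * ‖x‖ ≤ ‖Y x‖) : ∃ A ∈ M, A * Y = 1 ∧ ‖A‖ ≤ δ⁻¹ := by
  obtain ⟨S, hS⟩ : ∃ S : H →L[ℂ] H, S = star Y * Y := ⟨_, rfl⟩
  have hSM : S ∈ M := hS ▸ mul_mem (star_mem hY) hY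
  have hSinner : ∀ x, δ ^ 2 * ‖x‖ ^ 2 ≤ RCLike.re (inner ℂ (S x) x) := fun x => by
    rw [hS]
    change _ ≤ RCLike.re (inner ℂ ((ContinuousLinearMap.adjoint Y ∘L Y) x) x)
    rw [← Y.apply_norm_sq_eq_inner_adjoint_left, ← mul_pow]
    exact pow_le_pow_left₀ (by positivity) (h x) 2
  have hSx : ∀ x, δ ^ 2 * ‖x‖ ≤ ‖S x‖ := fun x => by
    obtain rfl | hx := eq_or_ne x 0
    · simp
    · have h1 := (hSinner x).trans ((RCLike.re_le_norm _).trans (norm_inner_le_norm (S x) x))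
      rw [sq ‖x‖, ← mul_assoc] at h1
      exact le_of_mul_le_mul_right h1 (norm_pos_iff.2 hx)
  have hSu : IsUnit S := by
    refine S.isUnit_of_forall_le_norm_inner_map (c := ⟨δ ^ 2, by positivity⟩)
      (by exact_mod_cast pow_pos hδ 2) fun x => ?_
    rw [mul_comm]
    exact (hSinner x).trans (RCLike.re_le_norm _)
  obtain ⟨R, rfl⟩ := hSu
  have hRM : (↑R⁻¹ : H →L[ℂ] H) ∈ M := mem_of_forall_mem_commutant fun y hy => by
    have : Commute y (R : H →L[ℂ] H) := mul_comm_of_mem_commutant hSM hy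
    exact this.units_inv_right.eq
  refine ⟨↑R⁻¹ * star Y, mul_mem hRM (star_mem hY), by rw [mul_assoc, ← hS, Units.inv_mul], ?_⟩
  have hR : ‖(↑R⁻¹ : H →L[ℂ] H)‖ ≤ (δ ^ 2)⁻¹ := by
    refine ContinuousLinearMap.opNorm_le_bound _ (by positivity) fun x => ?_
    rw [inv_mul_eq_div, le_div_iff₀ (by positivity), mul_comm]
    refine (hSx _).trans_eq ?_
    rw [← mul_apply_eq_comp, Units.mul_inv, one_apply_eq_self]
  -- For `A = S⁻¹ * star Y` one has `A * star A = S⁻¹`, so `‖A‖² = ‖S⁻¹‖ ≤ δ⁻²`.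
  rw [← sq_le_sq₀ (norm_nonneg _) (by positivity), sq, ← CStarRing.norm_self_mul_star, star_mul,
    star_star, mul_assoc, ← mul_assoc (star Y), ← hS, ← mul_assoc, Units.inv_mul, one_mul,
    norm_star, inv_pow]
  exact hR

/-- In a type III factor on a separable Hilbert space, every operator of norm greater than `δ` can
be compressed to the identity, at a cost of at most `δ⁻¹`. -/
lemma IsTypeIIIFactor.exists_mul_mul_eq_one [TopologicalSpace.SeparableSpace H]
    (hM : M.IsTypeIIIFactor) (T : M.toStarSubalgebra) {δ : ℝ} (hδ : 0 < δ) (hδT : δ < ‖T‖) :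
    ∃ A B : M.toStarSubalgebra, A * T * B = 1 ∧ ‖A‖ ≤ δ⁻¹ ∧ ‖B‖ ≤ 1 := by
  obtain ⟨e, he, he0, hTe⟩ := exists_isStarProjection_le_norm_apply T.2 hδ.le hδT
  obtain ⟨v, hvM, hv, hev⟩ := hM.isFactor.exists_isometry_of_not_isFiniteProjection he
    (mt (hM.eq_zero_of_isFiniteProjection e) he0)
  have hnorm := (ContinuousLinearMap.norm_map_iff_adjoint_comp_self v).2 hv
  obtain ⟨A, hAM, hA, hAδ⟩ := exists_mul_eq_one_of_le_norm_apply (Y := (T : H →L[ℂ] H) * v)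
    (mul_mem T.2 hvM) hδ fun x => by
      have h1 : (e : H →L[ℂ] H) (v x) = v x := congr($hev x)
      have h2 := hTe (v x)
      rwa [h1, hnorm] at h2
  refine ⟨⟨A, hAM⟩, ⟨v, hvM⟩, Subtype.ext ?_, hAδ, ?_⟩
  · change A * T * v = 1
    rw [mul_assoc, hA]
  · exact ContinuousLinearMap.opNorm_le_bound _ zero_le_one fun x => ((hnorm x).trans (one_mul _).symm).le

/-- A unitarily invariant generalized seminorm is dominated by the operator norm on either side. -/
lemma IsUnitarilyInvariant.apply_mul_mul_le {p : M.toStarSubalgebra → ℝ≥0∞}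
    (hu : M.IsUnitarilyInvariant p) (hp : M.IsGeneralizedSeminorm p) (A T B : M.toStarSubalgebra) :
    p (A * T * B) ≤ ENNReal.ofReal ‖A‖ * (ENNReal.ofReal ‖B‖ * p T) := by
  -- Norm closedness makes `M` a C*-algebra, so the unitary bound applies in each variable.
  have : IsClosed (M.toStarSubalgebra : Set (H →L[ℂ] H)) := M.isClosed_toStarSubalgebra
  refine le_norm_mul_of_forall_unitary (q := fun A => p (A * T * B)) (fun c x => ?_)
    (fun x y => ?_) (fun u hu' => ?_) A
  · simp only [smul_mul_assoc]
    exact hp.smul c _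
  · simp only [add_mul]
    exact hp.add_le _ _
  refine le_norm_mul_of_forall_unitary (q := fun B => p (u * T * B)) (fun c x => ?_)
    (fun x y => ?_) (fun v hv' => ?_) B
  · simp only [mul_smul_comm]
    exact hp.smul c _
  · simp only [mul_add]
    exact hp.add_le _ _
  · exact (hu u hu' v hv' T).le

/-- A unitarily invariant generalized seminorm on a type III factor is determined by its value at
the identity. -/
lemma IsTypeIIIFactor.apply_eq_norm_mul_apply_one [TopologicalSpace.SeparableSpace H]
    (hM : M.IsTypeIIIFactor) {p : M.toStarSubalgebra → ℝ≥0∞} (hu : M.IsUnitarilyInvariant p)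
    (hp : M.IsGeneralizedSeminorm p) (T : M.toStarSubalgebra) :
    p T = ENNReal.ofReal ‖T‖ * p 1 := by
  have h1 : ‖(1 : M.toStarSubalgebra)‖ ≤ 1 := ContinuousLinearMap.norm_id_le
  obtain rfl | hT := eq_or_ne T 0
  · simpa using hp.smul 0 0
  refine le_antisymm ?_ ?_
  · have := hu.apply_mul_mul_le hp T 1 1
    rw [mul_one, mul_one] at this
    refine this.trans ?_
    gcongr
    exact mul_le_of_le_one_left' (ENNReal.ofReal_le_one.2 h1)
  · have hpos : 0 < ‖T‖ := norm_pos_iff.2 hT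
    have hlt : ∀ δ ∈ Set.Ioo 0 ‖T‖, ENNReal.ofReal δ * p 1 ≤ p T := by
      rintro δ ⟨hδ, hδT⟩
      obtain ⟨A, B, hAB, hA, hB⟩ := hM.exists_mul_mul_eq_one T hδ hδT
      rw [← hAB]
      calc _ ≤ ENNReal.ofReal δ * (ENNReal.ofReal δ⁻¹ * (1 * p T)) := by
            grw [hu.apply_mul_mul_le hp A T B, ENNReal.ofReal_le_ofReal hA,
              ENNReal.ofReal_le_one.2 hB]
        _ = p T := by
            rw [one_mul, ← mul_assoc, ← ENNReal.ofReal_mul hδ.le, mul_inv_cancel₀ hδ.ne',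
              ENNReal.ofReal_one, one_mul]
    have ht : Filter.Tendsto (fun r : ℝ => ENNReal.ofReal r * p 1)
        (nhdsWithin ‖T‖ (Set.Iio ‖T‖)) (nhds (ENNReal.ofReal ‖T‖ * p 1)) :=
      ENNReal.Tendsto.mul_const
        ((ENNReal.continuous_ofReal.tendsto _).mono_left nhdsWithin_le_nhds) (Or.inl (by simpa))
    exact le_of_tendsto ht (Filter.eventually_of_mem (Ioo_mem_nhdsLT hpos) hlt)

end VonNeumannAlgebra

theorem theorem3p27 {H : Type*} [NormedAddCommGroup H] [InnerProductSpace ℂ H] [CompleteSpace H]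
    [TopologicalSpace.SeparableSpace H] (M : VonNeumannAlgebra H) (hM : M.IsTypeIIIFactor)
    (p : M.toStarSubalgebra → ℝ≥0∞) :
    (M.IsGeneralizedSeminorm p ∧ M.IsUnitarilyInvariant p) ↔
      ∃ a : ℝ, 0 < a ∧
        ∀ T : M.toStarSubalgebra, p T = ENNReal.ofReal (a * ‖(T : H →L[ℂ] H)‖) := by
  constructor
  · rintro ⟨hp, hu⟩
    have key := hM.apply_eq_norm_mul_apply_one hu hp
    obtain ⟨T, hT, hT0, hTtop⟩ := hp.exists_pos_lt_top
    rw [key] at hT0 hTtop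
    -- The witness `T` excludes both degenerate scales, `0` and `∞`.
    have h0 : p 1 ≠ 0 := fun h => by simp [h] at hT0
    have htop : p 1 ≠ ∞ := fun h => by
      rw [h, ENNReal.mul_top (by simpa using hT)] at hTtop
      exact hTtop.false
    refine ⟨(p 1).toReal, ENNReal.toReal_pos h0 htop, fun T => ?_⟩
    rw [ENNReal.ofReal_mul ENNReal.toReal_nonneg, ENNReal.ofReal_toReal htop, mul_comm]
    exact key T
  · rintro ⟨a, ha, h⟩
    have := hM.isFactor.nontrivial
    refine ⟨⟨fun c T => ?_, fun S T => ?_, 1, one_ne_zero, ?_, ?_⟩, fun U hU V hV T => ?_⟩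
    · rw [h, h, ← ENNReal.ofReal_mul (norm_nonneg _)]
      congr 1
      change a * ‖c • (T : H →L[ℂ] H)‖ = _
      rw [norm_smul]
      ring
    · rw [h, h, h, ← ENNReal.ofReal_add (by positivity) (by positivity), ← mul_add]
      gcongr
      exact norm_add_le _ _
    · rw [h, ENNReal.ofReal_pos]
      exact mul_pos ha (norm_pos_iff.2 (Subtype.coe_injective.ne (one_ne_zero (α := M.toStarSubalgebra))))
    · rw [h]
      exact ENNReal.ofReal_lt_top
    · have : IsClosed (M.toStarSubalgebra : Set (H →L[ℂ] H)) := M.isClosed_toStarSubalgebra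
      rw [h, h]
      congr 2
      change ‖U * T * V‖ = ‖T‖
      rw [CStarRing.norm_mul_mem_unitary _ hV, CStarRing.norm_mem_unitary_mul _ hU]
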